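/- Let $K$ be an algebraically closed field, let $H\subseteq K[X]=K[x_1,\dots,x_n]$ be an ideal, let $T=(t_1,\dots,t_r)\subseteq K[X]$ be an ideal given by generators, and let $U\subseteq\{x_1,\dots,x_n\}$ be a set of variables which is independent for $H$, i.e. $H\cap K[U]=0$, and such that $|U|=\dim H$ (the Krull dimension of $K[X]/H$). A component of $H$ is the variety $\mathbb V(P)\subseteq K^n$ of a minimal prime $P$ over $H$; $U$ remains independent on it if $P\cap K[U]=0$. For an ideal $I\subseteq K[U][y]$ in finitely many variables $y$, with parameters $U$, and a monomial order on the $y$, write $\sigma_{u_0}:K[U][y]\to K[y]$ for the specialization of the parameters at $u_0\in K^U$. A minimal canonical comprehensive Gröbner system (MCCGS) of $I$ with respect to $U$ is a finite family of pairs $(S_i,B_i)$ such that: (1) the $S_i$ (the segments) are nonempty constructible sets forming a partition of $K^U$; (2) each $B_i\subset K[U][y]$ is a finite set of polynomials of content $1$ with respect to $y$, whose leading coefficients vanish nowhere on $S_i$, and for every $u_0\in S_i$ the polynomials $\sigma_{u_0}(b)$, $b\in B_i$, divided by their leading coefficients, are pairwise distinct and form the reduced Gröbner basis of $\sigma_{u_0}(I)$;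 (3) no family with (1) and (2) has fewer segments. The generic segment is the unique segment containing a nonempty Zariski-open subset of $K^U$; its basis is called $1$ if it consists of a single nonzero constant of $K$. Take any MCCGS with respect to $U$, for any monomial orders, of the ideal $\{H,Tz-1\}$, that is, the ideal generated by $H$ and $t_1z_1+\dots+t_rz_r-1$ in $K[U][X\setminus U,z_1,\dots,z_r]$ (for a single polynomial $T$: by $H$ and $Tz-1$), and of the ideal $\{H,T\}=H+T$ in $K[U][X\setminus U]$. Then $T$ vanishes identically on some component of $H$ where $U$ remains independent, and also $T$ does not vanish identically on some other component of $H$ where $U$ remains independent, if and only if - the basis of the generic segment of the MCCGS of $\{H,Tz-1\}$ is different from $1$, and - the basis of the generic segment of the MCCGS of $\{H,T\}$ is different from $1$. -/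

import Mathlib

open MvPolynomial

noncomputable section

namespace ParamGB

/-! ### Reduced Gröbner bases over a field -/

/-- `G` is a Gröbner basis of the ideal `J`: it is a subset of `J` and its leading terms generate
the ideal of leading terms of `J`. -/
def IsGroebnerBasis {ν K : Type*} [Field K] (m : MonomialOrder ν)
    (G : Set (MvPolynomial ν K)) (J : Ideal (MvPolynomial ν K)) : Prop :=
  G ⊆ J ∧ Ideal.span (m.leadingTerm '' G) = Ideal.span (m.leadingTerm '' (J : Set _))

/-- The reduced Gröbner basis: a finite Gröbner basis of monic polynomials in which no power
product of an element is divisible by the leading power product of another element. -/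
def IsReducedGroebnerBasis {ν K : Type*} [Field K] (m : MonomialOrder ν)
    (G : Set (MvPolynomial ν K)) (J : Ideal (MvPolynomial ν K)) : Prop :=
  G.Finite ∧ IsGroebnerBasis m G J ∧ (∀ g ∈ G, m.Monic g) ∧
    ∀ g ∈ G, ∀ g' ∈ G, g' ≠ g → ∀ d ∈ g.support, ¬ m.degree g' ≤ d

/-- Divide a polynomial over a field by its leading coefficient. -/
def monicNormalization {ν K : Type*} [Field K] (m : MonomialOrder ν)
    (f : MvPolynomial ν K) : MvPolynomial ν K :=
  C (m.leadingCoeff f)⁻¹ * f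

/-! ### Parametric polynomials: coefficients in `A = K[u]`, parameters `u` indexed by `μ`,
variables `x` indexed by `ν` -/

/-- The specialization homomorphism `K[u][x] → K[x]`, substituting `u₀` for the parameters. -/
def specialize {ν μ K : Type*} [Field K] (u₀ : μ → K) :
    MvPolynomial ν (MvPolynomial μ K) →+* MvPolynomial ν K :=
  MvPolynomial.map (MvPolynomial.eval u₀)

/-- Content `1` with respect to the variables: the only common divisors in `K[u]` of the
coefficients are the nonzero constants. -/
def HasContentOne {ν μ K : Type*} [Field K] (b : MvPolynomial ν (MvPolynomial μ K)) : Prop :=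
  ∀ c : MvPolynomial μ K, (∀ d : ν →₀ ℕ, c ∣ b.coeff d) → IsUnit c

/-- Constructible subsets of the affine space `K^μ`: finite unions of differences of two Zariski
closed sets. -/
def IsConstructibleSet {μ K : Type*} [Field K] (S : Set (μ → K)) : Prop :=
  ∃ (k : ℕ) (F G : Fin k → Ideal (MvPolynomial μ K)),
    S = ⋃ j, zeroLocus K (F j) \ zeroLocus K (G j)

/-- A finite list of pairs (segment, finite set of parametric polynomials). -/
structure System (ν μ K : Type*) [Field K] where
  /-- the number of segments -/
  size : ℕ
  /-- the segments, subsets of the parameter space -/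
  segment : Fin size → Set (μ → K)
  /-- the set of polynomials attached to each segment -/
  basis : Fin size → Finset (MvPolynomial ν (MvPolynomial μ K))

/-- The segments are nonempty constructible sets which form a partition of the parameter space. -/
structure System.IsPartition {ν μ K : Type*} [Field K] (𝒢 : System ν μ K) : Prop where
  constructible : ∀ i, IsConstructibleSet (𝒢.segment i)
  nonempty : ∀ i, (𝒢.segment i).Nonempty
  disjoint : ∀ i j, i ≠ j → Disjoint (𝒢.segment i) (𝒢.segment j)
  cover : ⋃ i, 𝒢.segment i = Set.univ

/-- The polynomials of each basis have content `1`, their leading coefficients vanish nowhere on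
the segment (so the leading power products are kept), and, for each point `u₀` of the segment,
they specialize one-to-one (up to the nonzero leading coefficients) to the reduced Gröbner basis
of the specialized ideal. -/
structure System.SpecializesToReduced {ν μ K : Type*} [Field K] (𝒢 : System ν μ K)
    (m : MonomialOrder ν) (I : Ideal (MvPolynomial ν (MvPolynomial μ K))) : Prop where
  content : ∀ i, ∀ b ∈ 𝒢.basis i, HasContentOne b
  leadingCoeff_ne_zero : ∀ i, ∀ b ∈ 𝒢.basis i, ∀ u₀ ∈ 𝒢.segment i,
    MvPolynomial.eval u₀ (m.leadingCoeff b) ≠ 0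
  injOn : ∀ i, ∀ u₀ ∈ 𝒢.segment i,
    Set.InjOn (fun b => monicNormalization m (specialize u₀ b)) (𝒢.basis i : Set _)
  reduced : ∀ i, ∀ u₀ ∈ 𝒢.segment i,
    IsReducedGroebnerBasis m
      ((fun b => monicNormalization m (specialize u₀ b)) '' (𝒢.basis i : Set _))
      (I.map (specialize u₀))

/-- `𝒢` is a minimal comprehensive Gröbner system of the parametric ideal `I` with reduced
bases: among all partitions with bases specializing to the reduced Gröbner bases it has the
smallest number of segments. -/
structure System.IsMCCGS {ν μ K : Type*} [Field K] (𝒢 : System ν μ K)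
    (m : MonomialOrder ν) (I : Ideal (MvPolynomial ν (MvPolynomial μ K))) : Prop where
  partition : 𝒢.IsPartition
  specializes : 𝒢.SpecializesToReduced m I
  minimal : ∀ 𝒢' : System ν μ K, 𝒢'.IsPartition → 𝒢'.SpecializesToReduced m I →
    𝒢.size ≤ 𝒢'.size

/-- The generic segment: the one containing a nonempty Zariski open subset of the parameter space
(equivalently, the nonvanishing locus of a nonzero polynomial). -/
def System.IsGenericSegment {ν μ K : Type*} [Field K] (𝒢 : System ν μ K) (i : Fin 𝒢.size) :
    Prop :=
  ∃ g : MvPolynomial μ K, g ≠ 0 ∧ {u₀ : μ → K | MvPolynomial.eval u₀ g ≠ 0} ⊆ 𝒢.segment i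

/-- The basis is `1`. As content `1` fixes polynomials only up to nonzero scalars of `K`,
so does this. -/
def BasisIsOne {ν μ K : Type*} [Field K] (B : Finset (MvPolynomial ν (MvPolynomial μ K))) :
    Prop :=
  ∃ c : K, c ≠ 0 ∧ B = {C (C c)}

/-- There is a generic segment and its basis is different from `1`. -/
def System.GenericBasisNeOne {ν μ K : Type*} [Field K] (𝒢 : System ν μ K) : Prop :=
  ∃ i, 𝒢.IsGenericSegment i ∧ ¬ BasisIsOne (𝒢.basis i)

/-! ### Hypotheses, theses, independent components -/

/-- The variables in `U` are independent for the ideal `J`: `J ∩ K[U] = 0`. -/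
def IndependentFor {n : ℕ} {K : Type*} [Field K] (U : Finset (Fin n))
    (J : Ideal (MvPolynomial (Fin n) K)) : Prop :=
  ∀ g : MvPolynomial {i // i ∈ U} K, rename Subtype.val g ∈ J → g = 0

/-- The components of `H` (given by the minimal primes over `H`) on which `U` remains
independent. -/
def independentComponents {n : ℕ} {K : Type*} [Field K] (U : Finset (Fin n))
    (H : Ideal (MvPolynomial (Fin n) K)) : Set (Ideal (MvPolynomial (Fin n) K)) :=
  {P | P ∈ H.minimalPrimes ∧ IndependentFor U P}

/-- All polynomials of the family `t` vanish at all points of the variety of `P`. -/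
def VanishesOn {n r : ℕ} {K : Type*} [Field K] (t : Fin r → MvPolynomial (Fin n) K)
    (P : Ideal (MvPolynomial (Fin n) K)) : Prop :=
  ∀ a ∈ zeroLocus K P, ∀ j, MvPolynomial.eval a (t j) = 0

/-- View a polynomial of `K[X]` as an element of `K[U][X ∖ U]`: the variables in `U` become
parameters. -/
def toParametric {n : ℕ} {K : Type*} [Field K] (U : Finset (Fin n)) :
    MvPolynomial (Fin n) K →ₐ[K] MvPolynomial {i // i ∉ U} (MvPolynomial {i // i ∈ U} K) :=
  aeval fun i => if h : i ∈ U then C (X ⟨i, h⟩) else X ⟨i, h⟩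

/-- The parametric ideal generated by `H` and `T = (t₁, …, t_r)`. -/
def idealHT {n r : ℕ} {K : Type*} [Field K] (U : Finset (Fin n))
    (H : Ideal (MvPolynomial (Fin n) K)) (t : Fin r → MvPolynomial (Fin n) K) :
    Ideal (MvPolynomial {i // i ∉ U} (MvPolynomial {i // i ∈ U} K)) :=
  (H ⊔ Ideal.span (Set.range t)).map (toParametric U)

/-- The parametric ideal generated by `H` and `t₁ z₁ + ⋯ + t_r z_r - 1`, with new variables
`z₁, …, z_r`. For a single thesis polynomial `T` this is the ideal generated by `H` and
`T z - 1`. -/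
def idealHTz {n r : ℕ} {K : Type*} [Field K] (U : Finset (Fin n))
    (H : Ideal (MvPolynomial (Fin n) K)) (t : Fin r → MvPolynomial (Fin n) K) :
    Ideal (MvPolynomial ({i // i ∉ U} ⊕ Fin r) (MvPolynomial {i // i ∈ U} K)) :=
  Ideal.span
    ((fun h => rename Sum.inl (toParametric U h)) '' (H : Set _) ∪
      {∑ j, rename Sum.inl (toParametric U (t j)) * X (Sum.inr j) - 1})

end ParamGB

end

/-! The generic basis is `1` exactly when the parametric ideal meets K[U] nontrivially
(`System.genericBasisNeOne_iff`). A nonzero g in the intersection makes the specialization at some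
point of the generic segment the unit ideal, and content 1 then forces the basis to be a constant.
Conversely, if all specializations with g ≠ 0 are the unit ideal, the Nullstellensatz in parameters
and variables together puts a power of g in the ideal.

Two elimination statements remain. If H + T avoids K[U] \ {0}, so does some prime P above it; then
dim K[X]/P ≥ |U| = dim H, so P is minimal over H and is an independent component on which T vanishes
(`forall_C_mem_idealHT_iff`). For {H, Tz-1}, an independent component Q on which some t_j is nonzero
gives a point over Frac(K[X]/Q) with z_j = 1/t_j, where no nonzero element of K[U] vanishes. If
there is no such Q, a suitable g ≠ 0 in K[U] multiplies every t_j into the radical of H, and Tz = 1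
yields a power of g (`forall_C_mem_idealHTz_iff`). -/

/-! ### Krull dimension of quotients and finitely generated domains -/

/-- An injective integral extension does not lower the Krull dimension. -/
lemma ringKrullDim_le_of_isIntegral_of_injective {R S : Type*} [CommRing R] [CommRing S]
    [Algebra R S] [Algebra.IsIntegral R S] (h : Function.Injective (algebraMap R S)) :
    ringKrullDim R ≤ ringKrullDim S := by
  refine iSup_le fun l => ?_
  -- Lying over handles the bottom of the chain; going up lifts the rest without changing its
  -- length.
  obtain ⟨Q, hQ, hQl⟩ := Ideal.exists_ideal_over_prime_of_isIntegral l.head.asIdeal (⊥ : Ideal S)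
    (by rw [← RingHom.ker_eq_comap_bot, (RingHom.injective_iff_ker_eq_bot _).mp h]; exact bot_le)
  have := hQl.1
  have : Q.LiesOver l.head.asIdeal := ⟨hQl.2.symm⟩
  obtain ⟨L, hL, -⟩ := Ideal.exists_ltSeries_of_hasGoingUp l Q
  rw [← hL]
  exact le_iSup (fun p : LTSeries (PrimeSpectrum S) => ((p.length : ℕ∞) : WithBot ℕ∞)) L

/-- A finitely generated domain that contains a polynomial ring in `d` variables has Krull
dimension at least `d`. -/
lemma natCard_le_ringKrullDim_of_mvPolynomial_injective {K A ι : Type*} [Field K] [CommRing A]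
    [IsDomain A] [Algebra K A] [Algebra.FiniteType K A] [Finite ι] (f : MvPolynomial ι K →ₐ[K] A)
    (hf : Function.Injective f) : (Nat.card ι : WithBot ℕ∞) ≤ ringKrullDim A := by
  obtain ⟨s, g, hg, hint⟩ := exists_integral_inj_algHom_of_fg K A
  have hι : Nat.card ι ≤ s := by
    let _ := g.toRingHom.toAlgebra
    have : IsScalarTower K (MvPolynomial (Fin s) K) A :=
      IsScalarTower.of_algebraMap_eq fun x => (g.commutes x).symm
    have : Algebra.IsIntegral (MvPolynomial (Fin s) K) A := ⟨hint⟩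
    have : FaithfulSMul (MvPolynomial (Fin s) K) A :=
      (faithfulSMul_iff_algebraMap_injective _ _).mpr hg
    -- After Noether normalization `A` has transcendence degree `s`, which bounds the number of
    -- algebraically independent elements.
    have h₁ := lift_trdeg_add_eq K (MvPolynomial (Fin s) K) A
    have h₂ := lift_trdeg_le_of_injective f hf
    rw [trdeg_eq_zero (R := MvPolynomial (Fin s) K)] at h₁
    have h₃ := congrArg Cardinal.toNat h₁
    have h₄ := Cardinal.toNat_le_toNat h₂ (by
      rw [Cardinal.lift_lt_aleph0]; exact trdeg_lt_aleph0_of_finiteType)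
    simp at h₃ h₄
    rw [← h₃] at h₄
    exact h₄
  let _ := g.toRingHom.toAlgebra
  have : Algebra.IsIntegral (MvPolynomial (Fin s) K) A := ⟨hint⟩
  refine le_trans ?_ (ringKrullDim_le_of_isIntegral_of_injective
    (R := MvPolynomial (Fin s) K) (S := A) hg)
  rw [MvPolynomial.ringKrullDim_of_isNoetherianRing, ringKrullDim_eq_zero_of_field]
  simpa using hι

/-- If `P₀ < P` are primes over `I` then `R ⧸ I` has larger dimension than `R ⧸ P`. -/
lemma ringKrullDim_quotient_add_one_le_of_lt {R : Type*} [CommRing R] {I P₀ P : Ideal R}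
    [P₀.IsPrime] (hI : I ≤ P₀) (hlt : P₀ < P) :
    ringKrullDim (R ⧸ P) + 1 ≤ ringKrullDim (R ⧸ I) := by
  obtain ⟨x, hxP, hx⟩ := SetLike.exists_of_lt hlt
  -- The class of `x` is a nonzerodivisor in the domain `R ⧸ P₀` and dies in `R ⧸ P`.
  refine (ringKrullDim_succ_le_of_surjective (Ideal.Quotient.factor hlt.le)
    (Ideal.Quotient.factor_surjective hlt.le) (r := Ideal.Quotient.mk P₀ x)
    (mem_nonZeroDivisors_of_ne_zero ?_) ?_).trans
    (ringKrullDim_le_of_surjective _ (Ideal.Quotient.factor_surjective hI))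
  · rwa [Ne, Ideal.Quotient.eq_zero_iff_mem]
  · simpa [Ideal.Quotient.eq_zero_iff_mem] using hxP

namespace ParamGB

/-! ### The generic segment -/

lemma exists_eval_ne_zero {μ K : Type*} [Field K] [Infinite K] {g : MvPolynomial μ K}
    (hg : g ≠ 0) : ∃ u₀ : μ → K, eval u₀ g ≠ 0 := by
  by_contra! h
  exact hg (MvPolynomial.funext fun u => by simpa using h u)

/-- A constructible set either contains a nonempty open set or lies in a proper closed set. -/
lemma IsConstructibleSet.exists_ne_zero {μ K : Type*} [Field K] {S : Set (μ → K)}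
    (hS : IsConstructibleSet S) :
    ∃ g : MvPolynomial μ K, g ≠ 0 ∧
      ({u₀ | eval u₀ g ≠ 0} ⊆ S ∨ ∀ u₀ ∈ S, eval u₀ g = 0) := by
  obtain ⟨k, F, G, rfl⟩ := hS
  -- A piece with `F j = ⊥` and `G j ≠ ⊥` contains a nonempty open set; any other piece is empty or
  -- lies in a hypersurface.
  by_cases h : ∃ j, F j = ⊥ ∧ G j ≠ ⊥
  · obtain ⟨j, hF, hG⟩ := h
    obtain ⟨g, hgG, hg⟩ := Submodule.exists_mem_ne_zero_of_ne_bot hG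
    refine ⟨g, hg, Or.inl fun u hu => Set.mem_iUnion.mpr ⟨j, ?_, fun hu' => hu ?_⟩⟩
    · rw [hF, zeroLocus_bot]; trivial
    · simpa [aeval_eq_eval] using hu' g hgG
  · have key : ∀ j, ∃ f : MvPolynomial μ K, f ≠ 0 ∧
        ∀ u ∈ zeroLocus K (F j) \ zeroLocus K (G j), eval u f = 0 := by
      intro j
      by_cases hF : F j = ⊥
      · have hG : G j = ⊥ := by by_contra hG; exact h ⟨j, hF, hG⟩
        refine ⟨1, one_ne_zero, fun u hu => (hu.2 ?_).elim⟩
        rw [hG, zeroLocus_bot]; trivial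
      · obtain ⟨f, hfF, hf⟩ := Submodule.exists_mem_ne_zero_of_ne_bot hF
        exact ⟨f, hf, fun u hu => by simpa [aeval_eq_eval] using hu.1 f hfF⟩
    choose f hf hf' using key
    refine ⟨∏ j, f j, Finset.prod_ne_zero_iff.mpr fun j _ => hf j, Or.inr fun u hu => ?_⟩
    obtain ⟨j, hj⟩ := Set.mem_iUnion.mp hu
    rw [map_prod]
    exact Finset.prod_eq_zero (Finset.mem_univ j) (hf' j u hj)

/-- Otherwise finitely many hypersurfaces would cover the whole affine space, which is impossible
over an infinite field. -/
lemma System.IsPartition.exists_isGenericSegment {ν μ K : Type*} [Field K] [Infinite K]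
    {𝒢 : System ν μ K} (h𝒢 : 𝒢.IsPartition) : ∃ i, 𝒢.IsGenericSegment i := by
  by_contra! h
  have key : ∀ i, ∃ g : MvPolynomial μ K, g ≠ 0 ∧ ∀ u ∈ 𝒢.segment i, eval u g = 0 := by
    intro i
    obtain ⟨g, hg, hs | hs⟩ := (h𝒢.constructible i).exists_ne_zero
    · exact (h i ⟨g, hg, hs⟩).elim
    · exact ⟨g, hg, hs⟩
  choose g hg hg' using key
  obtain ⟨u, hu⟩ := exists_eval_ne_zero
    (Finset.prod_ne_zero_iff.mpr fun i (_ : i ∈ Finset.univ) => hg i)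
  obtain ⟨i, hi⟩ := Set.mem_iUnion.mp (h𝒢.cover.symm ▸ Set.mem_univ u : u ∈ ⋃ i, 𝒢.segment i)
  rw [map_prod] at hu
  exact hu (Finset.prod_eq_zero (Finset.mem_univ i) (hg' i u hi))

/-! ### Segments with basis `1` -/

/-- The reduced Gröbner basis of the unit ideal is `{1}`. -/
lemma IsReducedGroebnerBasis.eq_singleton_one {ν K : Type*} [Field K] {m : MonomialOrder ν}
    {G : Set (MvPolynomial ν K)} (hG : IsReducedGroebnerBasis m G ⊤) : G = {1} := by
  obtain ⟨-, ⟨-, hspan⟩, hmonic, hred⟩ := hG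
  have h1 : (1 : MvPolynomial ν K) ∈ Ideal.span (m.leadingTerm '' G) := by
    rw [hspan]
    exact Ideal.subset_span ⟨1, trivial, by simp [MonomialOrder.leadingTerm]⟩
  have hone : (1 : MvPolynomial ν K) ∈ G := by
    by_contra hone
    -- Without 1, every monic element of `G` has nonzero degree, so no leading term has a constant
    -- term.
    have hle : Ideal.span (m.leadingTerm '' G) ≤ RingHom.ker (constantCoeff (R := K) (σ := ν)) := by
      rw [Ideal.span_le]
      rintro _ ⟨g, hg, rfl⟩
      have hdeg : m.degree g ≠ 0 := fun hd => hone <| by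
        have := m.eq_C_of_degree_eq_zero hd
        rw [(hmonic g hg).leadingCoeff_eq_one, C_1] at this
        rwa [← this]
      classical
      simp [MonomialOrder.leadingTerm, RingHom.mem_ker, constantCoeff_eq, coeff_monomial, hdeg]
    have := hle h1
    simp [RingHom.mem_ker] at this
  refine Set.eq_singleton_iff_unique_mem.mpr ⟨hone, fun g hg => ?_⟩
  by_contra hne
  refine hred g hg 1 hone (Ne.symm hne) (m.degree g) ?_ (by simp)
  exact m.degree_mem_support (hmonic g hg).ne_zero

/-- On a segment of a system, the basis is `1` as soon as one specialized ideal is the unit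
ideal. -/
lemma System.SpecializesToReduced.basisIsOne {ν μ K : Type*} [Field K] {𝒢 : System ν μ K}
    {m : MonomialOrder ν} {I : Ideal (MvPolynomial ν (MvPolynomial μ K))}
    (h𝒢 : 𝒢.SpecializesToReduced m I) {i : Fin 𝒢.size} {u₀ : μ → K} (hu₀ : u₀ ∈ 𝒢.segment i)
    (htop : I.map (specialize u₀) = ⊤) : BasisIsOne (𝒢.basis i) := by
  have hred := h𝒢.reduced i u₀ hu₀
  rw [htop] at hred
  have himg := hred.eq_singleton_one
  obtain ⟨b, hb, hb1⟩ : (1 : MvPolynomial ν K) ∈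
      (fun b => monicNormalization m (specialize u₀ b)) '' (𝒢.basis i : Set _) := by
    rw [himg]; rfl
  have hB : 𝒢.basis i = {b} := by
    refine Finset.eq_singleton_iff_unique_mem.mpr ⟨hb, fun b' hb' => ?_⟩
    refine h𝒢.injOn i u₀ hu₀ hb' hb (Eq.trans ?_ hb1.symm)
    have := Set.mem_image_of_mem (fun b => monicNormalization m (specialize u₀ b)) hb'
    rwa [himg] at this
  have hlc := h𝒢.leadingCoeff_ne_zero i b hb u₀ hu₀
  have hdeg : m.degree b = 0 := by
    classical
    by_contra hdeg
    -- The leading coefficient of `b` survives at `u₀`, so a nonzero degree would leave a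
    -- nonconstant term in the normalization, which is 1.
    have h := congrArg (coeff (m.degree b)) hb1
    simp only [monicNormalization, coeff_C_mul, specialize, coeff_map, coeff_one,
      if_neg (Ne.symm hdeg), mul_eq_zero, inv_eq_zero] at h
    rcases h with h | h
    · simp [monicNormalization, specialize, h] at hb1
    · exact hlc h
  have hbC := m.eq_C_of_degree_eq_zero hdeg
  have hunit : IsUnit (m.leadingCoeff b) := h𝒢.content i b hb _ fun d => by
    classical
    rw [hbC, coeff_C]
    split_ifs
    · simp
    · exact dvd_zero _
  obtain ⟨c, hc, hc'⟩ := MvPolynomial.isUnit_iff_eq_C_of_isReduced.mp hunit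
  refine ⟨c, hc.ne_zero, ?_⟩
  rw [hB, hbC, hc']

/-- If the basis of a segment is `1`, all the specialized ideals are the unit ideal. -/
lemma System.SpecializesToReduced.map_eq_top {ν μ K : Type*} [Field K] {𝒢 : System ν μ K}
    {m : MonomialOrder ν} {I : Ideal (MvPolynomial ν (MvPolynomial μ K))}
    (h𝒢 : 𝒢.SpecializesToReduced m I) {i : Fin 𝒢.size} (hi : BasisIsOne (𝒢.basis i))
    {u₀ : μ → K} (hu₀ : u₀ ∈ 𝒢.segment i) : I.map (specialize u₀) = ⊤ := by
  obtain ⟨c, hc, hB⟩ := hi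
  refine (Ideal.eq_top_iff_one _).mpr ((h𝒢.reduced i u₀ hu₀).2.1.1 ⟨C (C c), by simp [hB], ?_⟩)
  simp [monicNormalization, specialize, ← C_mul, hc]

/-- If the ideal specializes to the unit ideal wherever `g ≠ 0`, a power of `g` lies in it. -/
lemma exists_C_pow_mem_of_map_eq_top {ν μ K : Type*} [Field K] [IsAlgClosed K] [Finite ν]
    [Finite μ] {I : Ideal (MvPolynomial ν (MvPolynomial μ K))} {g : MvPolynomial μ K}
    (hg : ∀ u₀ : μ → K, eval u₀ g ≠ 0 → I.map (specialize u₀) = ⊤) :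
    ∃ k : ℕ, C (g ^ k) ∈ I := by
  let e := sumAlgEquiv K ν μ
  have heval : ∀ (a : ν ⊕ μ → K) (p : MvPolynomial (ν ⊕ μ) K),
      eval (a ∘ Sum.inl) (specialize (a ∘ Sum.inr) (e p)) = aeval a p := by
    intro a p
    have : ((eval (a ∘ Sum.inl)).comp ((specialize (a ∘ Sum.inr)).comp (e : _ →+* _))) =
        (aeval a : MvPolynomial (ν ⊕ μ) K →ₐ[K] K).toRingHom := by
      ext x
      · simp [e, specialize]
      · rcases x with x | x <;> simp [e, specialize]
    exact congrArg (fun f => f p) this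
  -- Nullstellensatz: a zero of `I` with `g ≠ 0` would be a zero of a specialized ideal equal to
  -- `⊤`.
  have hmem : e.symm (C g) ∈ (I.comap (e : _ →+* MvPolynomial ν (MvPolynomial μ K))).radical := by
    rw [← vanishingIdeal_zeroLocus_eq_radical (K := K), mem_vanishingIdeal_iff]
    intro a ha
    by_contra hne
    have hga : eval (a ∘ Sum.inr) g ≠ 0 := by
      rw [← heval] at hne
      simpa [specialize] using hne
    have hle : I.map (specialize (a ∘ Sum.inr)) ≤ RingHom.ker (eval (a ∘ Sum.inl)) := by
      rw [Ideal.map_le_iff_le_comap]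
      intro p hp
      have := ha (e.symm p) (by simpa using hp)
      rw [← heval] at this
      simpa [RingHom.mem_ker] using this
    rw [hg _ hga] at hle
    have := hle (Submodule.mem_top : (1 : MvPolynomial ν K) ∈ ⊤)
    simp [RingHom.mem_ker] at this
  obtain ⟨k, hk⟩ := hmem
  exact ⟨k, by simpa using hk⟩

/-- The generic basis differs from `1` exactly when the ideal contains no nonzero polynomial in
the parameters alone. -/
lemma System.genericBasisNeOne_iff {ν μ K : Type*} [Field K] [IsAlgClosed K] [Finite ν] [Finite μ]
    {𝒢 : System ν μ K} {m : MonomialOrder ν} {I : Ideal (MvPolynomial ν (MvPolynomial μ K))}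
    (hpart : 𝒢.IsPartition) (hspec : 𝒢.SpecializesToReduced m I) :
    𝒢.GenericBasisNeOne ↔ ∀ g : MvPolynomial μ K, C g ∈ I → g = 0 := by
  have : Infinite K := IsAlgClosed.instInfinite
  constructor
  · rintro ⟨i, ⟨f, hf, hfi⟩, hone⟩ g hg
    by_contra hg0
    obtain ⟨u, hu⟩ := exists_eval_ne_zero (mul_ne_zero hf hg0)
    rw [map_mul] at hu
    refine hone (hspec.basisIsOne (hfi (left_ne_zero_of_mul hu)) ?_)
    refine Ideal.eq_top_of_isUnit_mem _ (Ideal.mem_map_of_mem (specialize u) hg) ?_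
    simpa [specialize] using right_ne_zero_of_mul hu
  · intro h
    obtain ⟨i, hi⟩ := hpart.exists_isGenericSegment
    refine ⟨i, hi, fun hone => ?_⟩
    obtain ⟨f, hf, hfi⟩ := hi
    obtain ⟨k, hk⟩ := exists_C_pow_mem_of_map_eq_top fun u hu => hspec.map_eq_top hone (hfi hu)
    exact pow_ne_zero k hf (h _ hk)


/-! ### Elimination ideals and independent components -/

variable {n r : ℕ} {K : Type*} [Field K]

/-- Forget the distinction between parameters and variables. -/
noncomputable def ofParametric (U : Finset (Fin n)) :
    MvPolynomial {i // i ∉ U} (MvPolynomial {i // i ∈ U} K) →+* MvPolynomial (Fin n) K :=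
  eval₂Hom (rename Subtype.val : MvPolynomial {i // i ∈ U} K →ₐ[K] _).toRingHom fun i => X i.1

@[simp]
lemma ofParametric_C (U : Finset (Fin n)) (g : MvPolynomial {i // i ∈ U} K) :
    ofParametric U (C g) = rename Subtype.val g := by
  simp [ofParametric]

@[simp]
lemma ofParametric_toParametric (U : Finset (Fin n)) (p : MvPolynomial (Fin n) K) :
    ofParametric U (toParametric U p) = p := by
  have : (ofParametric U).comp (toParametric U : MvPolynomial (Fin n) K →ₐ[K] _).toRingHom =
      RingHom.id _ := by
    ext i
    · simp [ofParametric, toParametric, algebraMap_eq]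
    · by_cases h : i ∈ U <;> simp [ofParametric, toParametric, h]
  exact congrArg (fun f => f p) this

@[simp]
lemma toParametric_rename (U : Finset (Fin n)) (g : MvPolynomial {i // i ∈ U} K) :
    toParametric U (rename Subtype.val g) = C g := by
  induction g using MvPolynomial.induction_on with
  | C a => simp [toParametric, algebraMap_eq]
  | add p q hp hq => simp only [map_add, hp, hq]
  | mul_X p i hp => rw [map_mul, map_mul, hp, map_mul]; simp [toParametric, i.2]

lemma C_mem_idealHT_iff {U : Finset (Fin n)} {H : Ideal (MvPolynomial (Fin n) K)}
    {t : Fin r → MvPolynomial (Fin n) K} {g : MvPolynomial {i // i ∈ U} K} :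
    C g ∈ idealHT U H t ↔ rename Subtype.val g ∈ H ⊔ Ideal.span (Set.range t) := by
  constructor
  · intro h
    have hle : idealHT U H t ≤ (H ⊔ Ideal.span (Set.range t)).comap (ofParametric U) := by
      rw [idealHT, Ideal.map_le_iff_le_comap]
      intro p hp
      simpa using hp
    simpa using hle h
  · intro h
    rw [← toParametric_rename]
    exact Ideal.mem_map_of_mem (toParametric U) h

lemma vanishesOn_iff_forall_mem [IsAlgClosed K] {t : Fin r → MvPolynomial (Fin n) K}
    {P : Ideal (MvPolynomial (Fin n) K)} (hP : P.IsPrime) : VanishesOn t P ↔ ∀ j, t j ∈ P := by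
  constructor
  · intro h j
    rw [← IsPrime.vanishingIdeal_zeroLocus (K := K) P, mem_vanishingIdeal_iff]
    intro a ha
    simpa [aeval_eq_eval] using h a ha j
  · intro h a ha j
    simpa [aeval_eq_eval] using ha _ (h j)

lemma IndependentFor.mono {U : Finset (Fin n)} {I J : Ideal (MvPolynomial (Fin n) K)}
    (hJ : IndependentFor U J) (h : I ≤ J) : IndependentFor U I :=
  fun g hg => hJ g (h hg)

/-- An ideal for which `U` is independent is contained in such a prime ideal. -/
lemma IndependentFor.exists_le_isPrime {U : Finset (Fin n)} {J : Ideal (MvPolynomial (Fin n) K)}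
    (hJ : IndependentFor U J) : ∃ P : Ideal (MvPolynomial (Fin n) K),
      P.IsPrime ∧ J ≤ P ∧ IndependentFor U P := by
  -- The nonzero elements of K[U] form a multiplicative set disjoint from `J`.
  obtain ⟨P, hP, hJP, hdisj⟩ := Ideal.exists_le_prime_disjoint J
    ((nonZeroDivisors (MvPolynomial {i // i ∈ U} K)).map
      (rename Subtype.val : MvPolynomial {i // i ∈ U} K →ₐ[K] MvPolynomial (Fin n) K)) (by
      rw [Set.disjoint_left]
      rintro _ hx ⟨g, hg, rfl⟩
      exact nonZeroDivisors.ne_zero hg (hJ g hx))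
  refine ⟨P, hP, hJP, fun g hg => ?_⟩
  by_contra hg0
  exact Set.disjoint_left.mp hdisj hg ⟨g, mem_nonZeroDivisors_of_ne_zero hg0, rfl⟩

/-! ### Dimension forces minimality: the ideal H + T -/

lemma IndependentFor.card_le_ringKrullDim {U : Finset (Fin n)}
    {P : Ideal (MvPolynomial (Fin n) K)} (hP : P.IsPrime) (hU : IndependentFor U P) :
    (U.card : WithBot ℕ∞) ≤ ringKrullDim (MvPolynomial (Fin n) K ⧸ P) := by
  have h := natCard_le_ringKrullDim_of_mvPolynomial_injective
    ((Ideal.Quotient.mkₐ K P).comp (rename (Subtype.val : {i // i ∈ U} → Fin n)))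
    ((injective_iff_map_eq_zero _).mpr fun g hg => hU g (by
      simpa [Ideal.Quotient.eq_zero_iff_mem] using hg))
  simpa using h

/-- When `|U| = dim H`, a prime over `H` for which `U` is independent is minimal. -/
lemma mem_independentComponents_of_isPrime {U : Finset (Fin n)}
    {H P : Ideal (MvPolynomial (Fin n) K)}
    (hdim : ringKrullDim (MvPolynomial (Fin n) K ⧸ H) = (U.card : WithBot ℕ∞))
    (hP : P.IsPrime) (hHP : H ≤ P) (hU : IndependentFor U P) : P ∈ independentComponents U H := by
  obtain ⟨P₀, hP₀, hle⟩ := Ideal.exists_minimalPrimes_le hHP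
  rcases hle.eq_or_lt with rfl | hlt
  · exact ⟨hP₀, hU⟩
  have := hP₀.1.1
  have h := ringKrullDim_quotient_add_one_le_of_lt hP₀.1.2 hlt
  rw [hdim] at h
  have h' : ((U.card + 1 : ℕ) : WithBot ℕ∞) ≤ (U.card : WithBot ℕ∞) := by
    push_cast
    exact (add_le_add_left (hU.card_le_ringKrullDim hP) 1).trans h
  exact absurd (Nat.cast_le.mp h') (by simp)

lemma forall_C_mem_idealHT_iff [IsAlgClosed K] {U : Finset (Fin n)}
    {H : Ideal (MvPolynomial (Fin n) K)}
    (hdim : ringKrullDim (MvPolynomial (Fin n) K ⧸ H) = (U.card : WithBot ℕ∞))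
    (t : Fin r → MvPolynomial (Fin n) K) :
    (∀ g, C g ∈ idealHT U H t → g = 0) ↔ ∃ P ∈ independentComponents U H, VanishesOn t P := by
  simp only [C_mem_idealHT_iff]
  constructor
  · intro h
    obtain ⟨P, hP, hle, hU⟩ := IndependentFor.exists_le_isPrime h
    rw [sup_le_iff, Ideal.span_le] at hle
    exact ⟨P, mem_independentComponents_of_isPrime hdim hP hle.1 hU,
      (vanishesOn_iff_forall_mem hP).mpr fun j => hle.2 ⟨j, rfl⟩⟩
  · rintro ⟨P, ⟨hP, hU⟩, ht⟩
    refine hU.mono (sup_le hP.1.2 (Ideal.span_le.mpr ?_))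
    rintro _ ⟨j, rfl⟩
    exact (vanishesOn_iff_forall_mem hP.1.1).mp ht j

/-! ### Eliminating from H and Tz - 1 -/

/-- A nonzero polynomial in the variables `U` that lies in every component on which `U` does not
remain independent. -/
lemma exists_ne_zero_mem_dependent_minimalPrimes (U : Finset (Fin n))
    (H : Ideal (MvPolynomial (Fin n) K)) :
    ∃ g : MvPolynomial {i // i ∈ U} K, g ≠ 0 ∧
      ∀ Q ∈ H.minimalPrimes, ¬ IndependentFor U Q → rename Subtype.val g ∈ Q := by
  classical
  have key : ∀ Q : Ideal (MvPolynomial (Fin n) K), ∃ g : MvPolynomial {i // i ∈ U} K,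
      g ≠ 0 ∧ (¬ IndependentFor U Q → rename Subtype.val g ∈ Q) := by
    intro Q
    by_cases hQ : IndependentFor U Q
    · exact ⟨1, one_ne_zero, fun h => (h hQ).elim⟩
    · obtain ⟨g, hg, hg0⟩ : ∃ g : MvPolynomial {i // i ∈ U} K,
          rename Subtype.val g ∈ Q ∧ g ≠ 0 := by simpa [IndependentFor] using hQ
      exact ⟨g, hg0, fun _ => hg⟩
  choose g hg0 hg using key
  have hfin := H.finite_minimalPrimes_of_isNoetherianRing
  refine ⟨∏ Q ∈ hfin.toFinset, g Q, Finset.prod_ne_zero_iff.mpr fun Q _ => hg0 Q,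
    fun Q hQ hU => ?_⟩
  rw [map_prod]
  exact Ideal.mem_of_dvd _ (Finset.dvd_prod_of_mem _ (hfin.mem_toFinset.mpr hQ)) (hg Q hU)

lemma exists_C_pow_mem_idealHTz {U : Finset (Fin n)} {H : Ideal (MvPolynomial (Fin n) K)}
    {t : Fin r → MvPolynomial (Fin n) K} {g : MvPolynomial {i // i ∈ U} K}
    (h : ∀ j, rename Subtype.val g * t j ∈ H.radical) : ∃ k : ℕ, C (g ^ k) ∈ idealHTz U H t := by
  let φ : MvPolynomial (Fin n) K →+*
      MvPolynomial ({i // i ∉ U} ⊕ Fin r) (MvPolynomial {i // i ∈ U} K) :=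
    (rename Sum.inl).toRingHom.comp (toParametric U).toRingHom
  have hφ : H.map φ ≤ idealHTz U H t := Ideal.span_mono Set.subset_union_left
  have hrad : H.radical.map φ ≤ (idealHTz U H t).radical :=
    (Ideal.map_radical_le φ).trans (Ideal.radical_mono hφ)
  have hmem : (∑ j, φ (t j) * X (Sum.inr j) - 1) ∈ (idealHTz U H t).radical :=
    Ideal.le_radical (Ideal.subset_span (Or.inr rfl))
  have hg : φ (rename Subtype.val g) = C g := by simp [φ]
  -- Modulo the radical, `g` equals `g * ∑ t j * z j`, and each summand already lies there.
  have hsum : C g * ∑ j, φ (t j) * X (Sum.inr j) ∈ (idealHTz U H t).radical := by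
    rw [Finset.mul_sum]
    refine Ideal.sum_mem _ fun j _ => ?_
    rw [← mul_assoc, ← hg, ← map_mul]
    exact Ideal.mul_mem_right _ _ (hrad (Ideal.mem_map_of_mem φ (h j)))
  have : C g ∈ (idealHTz U H t).radical := by
    have h' := Ideal.sub_mem _ hsum (Ideal.mul_mem_left _ (C g) hmem)
    rwa [← mul_sub, sub_sub_cancel, mul_one] at h'
  obtain ⟨k, hk⟩ := this
  exact ⟨k, by simpa using hk⟩

/-- If some `t j` is not in the prime `Q ⊇ H`, the polynomials in `U` eliminated from
`H, ∑ t j * z j - 1` lie in `Q`. -/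
lemma rename_mem_of_C_mem_idealHTz {U : Finset (Fin n)} {H Q : Ideal (MvPolynomial (Fin n) K)}
    {t : Fin r → MvPolynomial (Fin n) K} (hQ : Q.IsPrime) (hHQ : H ≤ Q) {j : Fin r}
    (hj : t j ∉ Q) {g : MvPolynomial {i // i ∈ U} K} (hg : C g ∈ idealHTz U H t) :
    rename Subtype.val g ∈ Q := by
  let L := FractionRing (MvPolynomial (Fin n) K ⧸ Q)
  let π : MvPolynomial (Fin n) K →+* L :=
    (algebraMap (MvPolynomial (Fin n) K ⧸ Q) L).comp (Ideal.Quotient.mk Q)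
  have hπ : ∀ p, π p = 0 ↔ p ∈ Q := fun p => by
    rw [← Ideal.Quotient.eq_zero_iff_mem]
    exact map_eq_zero_iff (algebraMap (MvPolynomial (Fin n) K ⧸ Q) L) (IsFractionRing.injective _ L)
  -- Evaluation at the generic point of the variety of `Q`, with `z j = (t j)⁻¹` and all other `z i
  -- = 0`, so that `∑ t i * z i = 1`.
  let ψ : MvPolynomial ({i // i ∉ U} ⊕ Fin r) (MvPolynomial {i // i ∈ U} K) →+* L :=
    eval₂Hom (π.comp (rename Subtype.val).toRingHom)
      (Sum.elim (fun i => π (X i.1)) (Pi.single j (π (t j))⁻¹))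
  have hψ : ∀ p, ψ (rename Sum.inl (toParametric U p)) = π p := by
    intro p
    have : (ψ.comp (rename Sum.inl).toRingHom) = π.comp (ofParametric U) := by
      ext <;> simp [ψ, ofParametric]
    have h' := congrArg (fun f => f (toParametric U p)) this
    simpa using h'
  have hker : idealHTz U H t ≤ RingHom.ker ψ := by
    rw [idealHTz, Ideal.span_le, Set.union_subset_iff]
    constructor
    · rintro _ ⟨p, hp, rfl⟩
      simpa [RingHom.mem_ker, hψ, hπ] using hHQ hp
    · rw [Set.singleton_subset_iff]
      have hz : ∀ i, ψ (X (Sum.inr i)) = Pi.single (M := fun _ => L) j (π (t j))⁻¹ i :=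
        fun i => by simp [ψ]
      have hne : π (t j) ≠ 0 := fun h => hj ((hπ _).mp h)
      simp only [SetLike.mem_coe, RingHom.mem_ker, map_sub, map_sum, map_mul, hψ, hz, map_one]
      rw [Finset.sum_eq_single j (fun i _ hi => by simp [hi]) (by simp), Pi.single_eq_same,
        mul_inv_cancel₀ hne, sub_self]
  have := hker hg
  rw [RingHom.mem_ker] at this
  rw [← hπ]
  simpa [ψ] using this

lemma forall_C_mem_idealHTz_iff [IsAlgClosed K] (U : Finset (Fin n))
    (H : Ideal (MvPolynomial (Fin n) K)) (t : Fin r → MvPolynomial (Fin n) K) :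
    (∀ g, C g ∈ idealHTz U H t → g = 0) ↔ ∃ Q ∈ independentComponents U H, ¬ VanishesOn t Q := by
  constructor
  · intro h
    by_contra! hall
    obtain ⟨g, hg0, hg⟩ := exists_ne_zero_mem_dependent_minimalPrimes U H
    -- Each product lies in every minimal prime: `t j` in the independent ones, `g` in the others.
    obtain ⟨k, hk⟩ := exists_C_pow_mem_idealHTz (U := U) (H := H) (t := t) (g := g) fun j => by
      rw [← Ideal.sInf_minimalPrimes, Ideal.mem_sInf]
      intro Q hQ
      by_cases hU : IndependentFor U Q
      · exact Ideal.mul_mem_left _ _ ((vanishesOn_iff_forall_mem hQ.1.1).mp (hall Q ⟨hQ, hU⟩) j)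
      · exact Ideal.mul_mem_right _ _ (hg Q hQ hU)
    exact pow_ne_zero k hg0 (h _ hk)
  · rintro ⟨Q, ⟨hQ, hU⟩, ht⟩ g hg
    rw [vanishesOn_iff_forall_mem hQ.1.1] at ht
    push Not at ht
    obtain ⟨j, hj⟩ := ht
    exact hU g (rename_mem_of_C_mem_idealHTz hQ.1.1 hQ.1.2 hj hg)

end ParamGB

theorem corollary10 {K : Type*} [Field K] [IsAlgClosed K] {n r : ℕ}
    (H : Ideal (MvPolynomial (Fin n) K)) (t : Fin r → MvPolynomial (Fin n) K)
    (U : Finset (Fin n)) (hU : ParamGB.IndependentFor U H)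
    (hdim : ringKrullDim (MvPolynomial (Fin n) K ⧸ H) = (U.card : WithBot ℕ∞))
    (m₁ : MonomialOrder ({i // i ∉ U} ⊕ Fin r)) (m₂ : MonomialOrder {i // i ∉ U})
    (𝒢₁ : ParamGB.System ({i // i ∉ U} ⊕ Fin r) {i // i ∈ U} K)
    (h𝒢₁ : 𝒢₁.IsMCCGS m₁ (ParamGB.idealHTz U H t))
    (𝒢₂ : ParamGB.System {i // i ∉ U} {i // i ∈ U} K)
    (h𝒢₂ : 𝒢₂.IsMCCGS m₂ (ParamGB.idealHT U H t)) :
    ((∃ P ∈ ParamGB.independentComponents U H, ParamGB.VanishesOn t P) ∧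
      (∃ Q ∈ ParamGB.independentComponents U H, ¬ ParamGB.VanishesOn t Q)) ↔
    (𝒢₁.GenericBasisNeOne ∧ 𝒢₂.GenericBasisNeOne) := by
  rw [ParamGB.System.genericBasisNeOne_iff h𝒢₁.partition h𝒢₁.specializes,
    ParamGB.System.genericBasisNeOne_iff h𝒢₂.partition h𝒢₂.specializes,
    ParamGB.forall_C_mem_idealHTz_iff, ParamGB.forall_C_mem_idealHT_iff hdim, and_comm]
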